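/- For a Lebesgue measurable set $F\subseteq\mathbb R^2$ let $\operatorname{Per}(F)=\sup\{\int_F\operatorname{div}z\,dx : z\in C_c^\infty(\mathbb R^2;\mathbb R^2),\ |z|\le 1\}$. An integrable function $\kappa$ on $\mathbb R^2$ is a variational mean curvature of a set $E$ of finite perimeter if $E$ minimizes $F\mapsto\operatorname{Per}(F)-\int_F\kappa$ among all sets $F$ of finite perimeter. For $E\subseteq\mathbb R^2$ and $h\in L^1(\mathbb R^2)$ with $h>0$, let $(E_\lambda)_{\lambda>0}$ be minimizers of $F\mapsto\operatorname{Per}(F)-\lambda\int_F h$ among sets of finite perimeter $F\subseteq E$, with representatives chosen such that $E_\lambda\subseteq E_\mu$ for $\lambda<\mu$, and let $(E^c_\lambda)_{\lambda>0}$ be such a family for the complement $E^c$. An optimal curvature of $E$ with density $h$ is a function $\kappa_E$ which is almost everywhere given by $$\kappa_E(x)=\inf\{\lambda h(x) : \lambda>0,\ x\in E_\lambda\}\ (x\in E),\qquad \kappa_E(x)=-\inf\{\lambda h(x) : \lambda>0,\ x\in E^c_\lambda\}\ (x\in E^c).$$ Let $0\le r_1<r_2$ and let $\mathcal A=B(0,r_2)\setminus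 B(0,r_1)\subset\mathbb R^2$. Then $\mathcal A$ has an optimal curvature whose density $h$ equals $1$ on $\mathcal A$ and which is a variational mean curvature of $\mathcal A$ with least $L^1(\mathbb R^2)$ norm among all variational mean curvatures of $\mathcal A$. Moreover, every optimal curvature $\kappa_{\mathcal A}$ of $\mathcal A$ whose density $h$ equals $1$ on $\mathcal A$ is constant almost everywhere on $\mathcal A$, with $$\kappa_{\mathcal A}=\frac{2(r_1+r_2)}{r_2^2-r_1^2}\quad\text{a.e. on }\mathcal A.$$ -/

import Mathlib

open MeasureTheory Set
open scoped ContDiff ENNReal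

noncomputable section

namespace VarCurv

/-- The divergence of a vector field on `ℝ^d`. -/
def divergence {d : ℕ} (z : EuclideanSpace ℝ (Fin d) → EuclideanSpace ℝ (Fin d))
    (x : EuclideanSpace ℝ (Fin d)) : ℝ :=
  ∑ i, fderiv ℝ z x (EuclideanSpace.single i 1) i

/-- Smooth compactly supported vector fields on `ℝ^d` with sup norm (for the Euclidean norm on the
values) at most one. -/
def testFields (d : ℕ) : Set (EuclideanSpace ℝ (Fin d) → EuclideanSpace ℝ (Fin d)) :=
  {z | ContDiff ℝ ∞ z ∧ HasCompactSupport z ∧ ∀ x, ‖z x‖ ≤ 1}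

/-- The total variation `sup {∫ u div z}` over the test fields. As `testFields` is stable under
`z ↦ -z`, cutting off negative values by `ENNReal.ofReal` does not change the supremum. -/
def totalVariation {d : ℕ} (u : EuclideanSpace ℝ (Fin d) → ℝ) : ℝ≥0∞ :=
  ⨆ z ∈ testFields d, ENNReal.ofReal (∫ x, u x * divergence z x)

/-- The perimeter of a set, with value `∞` for sets that are not of finite perimeter. -/
def perimeter {d : ℕ} (E : Set (EuclideanSpace ℝ (Fin d))) : ℝ≥0∞ :=
  totalVariation (E.indicator fun _ => 1)

/-- Measurable sets of finite perimeter. -/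
def FinitePerimeter {d : ℕ} (E : Set (EuclideanSpace ℝ (Fin d))) : Prop :=
  MeasurableSet E ∧ perimeter E < ⊤

/-- The functional `F ↦ Per F - ∫_F g`, used on sets of finite perimeter and for integrable `g`. -/
def energy {d : ℕ} (g : EuclideanSpace ℝ (Fin d) → ℝ) (F : Set (EuclideanSpace ℝ (Fin d))) : ℝ :=
  (perimeter F).toReal - ∫ x in F, g x

/-- `M` minimizes `F ↦ Per F - ∫_F g` among the subsets `F` of `E`. (Sets of infinite perimeter have
infinite energy and need not be tested, `g` being integrable.) -/
structure IsMinimizerIn {d : ℕ} (g : EuclideanSpace ℝ (Fin d) → ℝ)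
    (E M : Set (EuclideanSpace ℝ (Fin d))) : Prop where
  subset : M ⊆ E
  finitePerimeter : FinitePerimeter M
  le : ∀ F, F ⊆ E → FinitePerimeter F → energy g M ≤ energy g F

/-- `κ ∈ L¹(ℝ^d)` is a variational mean curvature of `E`. -/
def IsVariationalCurvature {d : ℕ} (E : Set (EuclideanSpace ℝ (Fin d)))
    (κ : EuclideanSpace ℝ (Fin d) → ℝ) : Prop :=
  Integrable κ ∧ IsMinimizerIn κ univ E

/-- A family `(S l)`, `l > 0`, of minimizers of `F ↦ Per F - l ∫_F h` among the subsets of `E`.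
Minimizers are determined only up to null sets, and are nested up to null sets; the
representatives are taken such that they are nested. -/
structure IsMinimizerFamily {d : ℕ} (h : EuclideanSpace ℝ (Fin d) → ℝ)
    (E : Set (EuclideanSpace ℝ (Fin d))) (S : ℝ → Set (EuclideanSpace ℝ (Fin d))) : Prop where
  minimizes : ∀ l, 0 < l → IsMinimizerIn (fun x => l * h x) E (S l)
  nested : ∀ l m, 0 < l → l < m → S l ⊆ S m

/-- The function `x ↦ inf {l h(x) | l > 0, x ∈ S l}`. -/
def levelCurvature {d : ℕ} (h : EuclideanSpace ℝ (Fin d) → ℝ)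
    (S : ℝ → Set (EuclideanSpace ℝ (Fin d))) (x : EuclideanSpace ℝ (Fin d)) : ℝ :=
  sInf {t | ∃ l, 0 < l ∧ x ∈ S l ∧ t = l * h x}

/-- Densities: positive functions in `L¹(ℝ^d)`. -/
def IsDensity {d : ℕ} (h : EuclideanSpace ℝ (Fin d) → ℝ) : Prop :=
  Integrable h ∧ ∀ᵐ x, 0 < h x

/-- `κ` is the optimal curvature of `E` built with the density `h`: on `E` it is the level curvature
of `E`, outside of `E` it is minus the level curvature of the complement of `E`. -/
structure IsOptimalCurvature {d : ℕ} (h : EuclideanSpace ℝ (Fin d) → ℝ)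
    (E : Set (EuclideanSpace ℝ (Fin d))) (κ : EuclideanSpace ℝ (Fin d) → ℝ) : Prop where
  inside : ∃ S, IsMinimizerFamily h E S ∧
    ∀ᵐ x ∂(volume.restrict E), κ x = levelCurvature h S x
  outside : ∃ S, IsMinimizerFamily h Eᶜ S ∧
    ∀ᵐ x ∂(volume.restrict Eᶜ), κ x = -levelCurvature h S x

/-- The planar annulus `B(0, r₂) \ B(0, r₁)`. -/
def annulus (r₁ r₂ : ℝ) : Set (EuclideanSpace ℝ (Fin 2)) :=
  Metric.ball 0 r₂ \ Metric.ball 0 r₁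

end VarCurv

end

noncomputable section

open Filter Topology Metric
open scoped NNReal Convolution

namespace VarCurv

/-! ### Perimeter as a functional, and its bound by outer Minkowski content. -/

section

variable {d : ℕ}

/-! The proof is a calibration. Consider the radial field `z x = f(‖x‖) • x`, whose divergence in
the plane is `2 f + r f'`. On the annulus take `f = a + b / r ^ 2`, so that the divergence is
constant, and fix `a`, `b` by asking `f r * r` to be `-1` at `r₁` and `1` at `r₂`; this gives the
divergence `2 / (r₂ - r₁)`. Inside, `f = -1 / r₁`; outside, `f = r₂ ^ 2 / r ^ 3`. Then `‖z‖ ≤ 1`,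
and `κ = div z` is integrable, positive on the annulus and negative off it.

Testing with `z` and `-z` gives `|∫_F κ| ≤ Per F` for every `F`
(`abs_integral_annulusCurvature_le`). Equality holds for the annulus, because the Minkowski content
bounds its perimeter by `2π(r₁ + r₂)`, which is the value of the integral
(`integral_annulusCurvature_annulus`). Since `∫ κ = 0`, equality also holds, with opposite sign, for
the complement.

So `κ` is a variational curvature with `‖κ‖₁ = 2 Per`, and comparison with `∅` and the whole plane
shows that no variational curvature has smaller norm (`two_mul_perimeter_le_integral_norm`). If `h =
1` on the annulus, with `c = 2 / (r₂ - r₁)`, the inequality `c * ∫_F h ≤ Per F` for subsets, with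
equality for the annulus, makes minimizers null below level `c` and full above it, so every optimal
curvature equals `c` there (`IsCalibrated.levelCurvature_eq`). -/

lemma neg_mem_testFields {z : EuclideanSpace ℝ (Fin d) → EuclideanSpace ℝ (Fin d)}
    (hz : z ∈ testFields d) : -z ∈ testFields d :=
  ⟨hz.1.neg, hz.2.1.neg, fun x => by simpa using hz.2.2 x⟩

lemma divergence_neg (z : EuclideanSpace ℝ (Fin d) → EuclideanSpace ℝ (Fin d))
    (x : EuclideanSpace ℝ (Fin d)) : divergence (-z) x = -divergence z x := by
  simp [divergence, fderiv_neg]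

lemma continuous_divergence {z : EuclideanSpace ℝ (Fin d) → EuclideanSpace ℝ (Fin d)}
    (hz : z ∈ testFields d) : Continuous (divergence z) := by
  have h : Continuous (fderiv ℝ z) := hz.1.continuous_fderiv (by simp)
  unfold divergence
  fun_prop

lemma hasCompactSupport_divergence {z : EuclideanSpace ℝ (Fin d) → EuclideanSpace ℝ (Fin d)}
    (hz : HasCompactSupport z) : HasCompactSupport (divergence z) :=
  (hz.fderiv ℝ).mono fun x hx => by
    contrapose! hx
    simp_all [divergence]

lemma integrable_divergence {z : EuclideanSpace ℝ (Fin d) → EuclideanSpace ℝ (Fin d)}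
    (hz : z ∈ testFields d) : Integrable (divergence z) :=
  (continuous_divergence hz).integrable_of_hasCompactSupport (hasCompactSupport_divergence hz.2.1)

/-- Integration by parts of a Lipschitz function against the divergence of a test field. -/
theorem integral_mul_divergence {u : EuclideanSpace ℝ (Fin d) → ℝ} {C : ℝ≥0}
    (hu : LipschitzWith C u) {z : EuclideanSpace ℝ (Fin d) → EuclideanSpace ℝ (Fin d)}
    (hz : z ∈ testFields d) :
    ∫ x, u x * divergence z x = -∫ x, fderiv ℝ u x (z x) := by
  have hzi (i : Fin d) : ContDiff ℝ 1 fun x => z x i :=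
    contDiff_euclidean.1 (hz.1.of_le (by simp)) i
  have hsupp (i : Fin d) : HasCompactSupport fun x => z x i :=
    hz.2.1.mono fun x hx => by
      contrapose! hx
      simp_all
  have hlip (i : Fin d) : ∃ D, LipschitzWith D fun x => z x i :=
    (hzi i).lipschitzWith_of_hasCompactSupport (hsupp i) (by simp)
  choose D hD using hlip
  have hderiv (i : Fin d) (x v) : lineDeriv ℝ (fun x => z x i) x v = fderiv ℝ z x v i := by
    rw [((hzi i).differentiable (by simp) x).lineDeriv_eq_fderiv]
    have h := (EuclideanSpace.proj (𝕜 := ℝ) i).hasFDerivAt.comp x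
      ((hz.1.differentiable (by simp)) x).hasFDerivAt
    exact congrArg (· v) h.fderiv
  have hcont : Continuous (fderiv ℝ z) := hz.1.continuous_fderiv (by simp)
  have hint1 (i : Fin d) : Integrable fun x => lineDeriv ℝ u x (EuclideanSpace.single i 1) * z x i := by
    have : Integrable fun x => z x i :=
      (hzi i).continuous.integrable_of_hasCompactSupport (hsupp i)
    exact this.bdd_mul (hu.memLp_lineDeriv _).1
      (.of_forall fun x => norm_lineDeriv_le_of_lipschitz ℝ hu)
  have hint2 (i : Fin d) :
      Integrable fun x => u x * fderiv ℝ z x (EuclideanSpace.single i 1) i := by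
    refine Continuous.integrable_of_hasCompactSupport ?_ ?_
    · have := hu.continuous
      fun_prop
    · refine (hz.2.1.fderiv ℝ).mono fun x hx => ?_
      contrapose! hx
      simp_all
  have key (i : Fin d) := hu.integral_lineDeriv_mul_eq (μ := volume) (hD i) (hsupp i)
    (EuclideanSpace.single i 1)
  calc ∫ x, u x * divergence z x
      = ∑ i, ∫ x, u x * fderiv ℝ z x (EuclideanSpace.single i 1) i := by
        rw [← integral_finsetSum _ fun i _ => hint2 i]
        simp [divergence, Finset.mul_sum]
    _ = -∑ i, ∫ x, lineDeriv ℝ u x (EuclideanSpace.single i 1) * z x i := by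
        simp_rw [key, hderiv, ← Finset.sum_neg_distrib, ← integral_neg]
        simp [mul_comm]
    _ = -∫ x, fderiv ℝ u x (z x) := by
        rw [← integral_finsetSum _ fun i _ => hint1 i]
        congr 1
        -- Rademacher's theorem turns line derivatives into the full derivative almost everywhere.
        refine integral_congr_ae ?_
        filter_upwards [hu.ae_differentiableAt] with x hx
        simp_rw [hx.lineDeriv_eq_fderiv]
        conv_rhs => rw [← (EuclideanSpace.basisFun (Fin d) ℝ).sum_repr (z x)]
        simp [mul_comm]

lemma integral_divergence_eq_zero {z : EuclideanSpace ℝ (Fin d) → EuclideanSpace ℝ (Fin d)}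
    (hz : z ∈ testFields d) : ∫ x, divergence z x = 0 := by
  simpa using integral_mul_divergence (LipschitzWith.const (1 : ℝ)) hz

lemma integral_indicator_mul_divergence {F : Set (EuclideanSpace ℝ (Fin d))}
    (hF : MeasurableSet F) (z : EuclideanSpace ℝ (Fin d) → EuclideanSpace ℝ (Fin d)) :
    ∫ x, F.indicator (fun _ => (1 : ℝ)) x * divergence z x = ∫ x in F, divergence z x := by
  rw [← integral_indicator hF]
  simp [← indicator_mul_left]

lemma le_perimeter {F : Set (EuclideanSpace ℝ (Fin d))} (hF : MeasurableSet F)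
    {z : EuclideanSpace ℝ (Fin d) → EuclideanSpace ℝ (Fin d)} (hz : z ∈ testFields d) :
    ENNReal.ofReal (∫ x in F, divergence z x) ≤ perimeter F := by
  rw [← integral_indicator_mul_divergence hF]
  exact le_iSup₂ (f := fun z (_ : z ∈ testFields d) =>
    ENNReal.ofReal (∫ x, F.indicator (fun _ => (1 : ℝ)) x * divergence z x)) z hz

lemma perimeter_le {F : Set (EuclideanSpace ℝ (Fin d))} (hF : MeasurableSet F) {c : ℝ≥0∞}
    (h : ∀ z ∈ testFields d, ENNReal.ofReal (∫ x in F, divergence z x) ≤ c) :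
    perimeter F ≤ c :=
  iSup₂_le fun z hz => by
    rw [integral_indicator_mul_divergence hF]
    exact h z hz

/-- A test field has divergence of total integral zero, so testing the complement with `z` is
testing the set with `-z`. -/
lemma perimeter_compl_le {F : Set (EuclideanSpace ℝ (Fin d))} (hF : MeasurableSet F) :
    perimeter Fᶜ ≤ perimeter F := by
  refine perimeter_le hF.compl fun z hz => ?_
  convert le_perimeter hF (neg_mem_testFields hz) using 2
  have h1 := integral_add_compl hF (integrable_divergence hz)
  rw [integral_divergence_eq_zero hz] at h1
  simp only [divergence_neg, integral_neg]
  linarith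

/-- Complementary sets have the same perimeter. -/
theorem perimeter_compl {F : Set (EuclideanSpace ℝ (Fin d))} (hF : MeasurableSet F) :
    perimeter Fᶜ = perimeter F :=
  (perimeter_compl_le hF).antisymm (by simpa using perimeter_compl_le hF.compl)

@[simp] lemma perimeter_empty : perimeter (∅ : Set (EuclideanSpace ℝ (Fin d))) = 0 := by
  simp [perimeter, totalVariation]

@[simp] lemma perimeter_univ : perimeter (univ : Set (EuclideanSpace ℝ (Fin d))) = 0 := by
  rw [← compl_empty, perimeter_compl .empty, perimeter_empty]

lemma finitePerimeter_empty : FinitePerimeter (∅ : Set (EuclideanSpace ℝ (Fin d))) :=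
  ⟨.empty, by simp⟩

lemma finitePerimeter_univ : FinitePerimeter (univ : Set (EuclideanSpace ℝ (Fin d))) :=
  ⟨.univ, by simp⟩

/-- A thickened indicator, tested against a divergence, is controlled by the volume of the shell
on which it is not constant. -/
lemma integral_thickenedIndicator_mul_divergence_le {A : Set (EuclideanSpace ℝ (Fin d))}
    {ε : ℝ} (hε : 0 < ε) (hvol : volume (thickening ε A \ A) ≠ ⊤) (hA : MeasurableSet A)
    {z : EuclideanSpace ℝ (Fin d) → EuclideanSpace ℝ (Fin d)} (hz : z ∈ testFields d) :
    ∫ x, (thickenedIndicator hε A x : ℝ) * divergence z x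
      ≤ ε⁻¹ * volume.real (thickening ε A \ A) := by
  set u : EuclideanSpace ℝ (Fin d) → ℝ := fun x => (thickenedIndicator hε A x : ℝ) with hu
  have hlip : LipschitzWith (ε.toNNReal)⁻¹ u := by
    exact fun x y => lipschitzWith_thickenedIndicator hε A x y
  have hpt (x) : ‖-fderiv ℝ u x (z x)‖ ≤ (thickening ε A \ A).indicator (fun _ => ε⁻¹) x := by
    by_cases hx : x ∈ thickening ε A \ A
    · rw [indicator_of_mem hx, norm_neg]
      calc ‖fderiv ℝ u x (z x)‖ ≤ ‖fderiv ℝ u x‖ * ‖z x‖ := (fderiv ℝ u x).le_opNorm _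
        _ ≤ ε⁻¹ * 1 := by
          gcongr
          · simpa [hε.le] using norm_fderiv_le_of_lipschitz ℝ hlip (x₀ := x)
          · exact hz.2.2 x
        _ = ε⁻¹ := mul_one _
    -- Off the shell `u` attains its maximum 1 or its minimum 0. The extremum criterion needs no
    -- differentiability, as `fderiv` is 0 where there is none.
    · have h0 : fderiv ℝ u x = 0 := by
        by_cases hxA : x ∈ A
        · refine IsLocalMax.fderiv_eq_zero (.of_forall fun y => ?_)
          simp only [hu, thickenedIndicator_one hε A hxA]
          exact_mod_cast thickenedIndicator_le_one hε A y
        · refine IsLocalMin.fderiv_eq_zero (.of_forall fun y => ?_)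
          simp only [hu, thickenedIndicator_zero hε A fun h => hx ⟨h, hxA⟩]
          positivity
      simp [h0, indicator_of_notMem hx]
  have hmeas : MeasurableSet (thickening ε A \ A) := isOpen_thickening.measurableSet.diff hA
  rw [integral_mul_divergence hlip hz, ← integral_neg]
  calc ∫ x, -fderiv ℝ u x (z x) ≤ ∫ x, (thickening ε A \ A).indicator (fun _ => ε⁻¹) x := by
        refine (le_abs_self _).trans ((norm_integral_le_of_norm_le ?_ (.of_forall hpt)))
        exact (integrable_indicator_iff hmeas).2 (integrableOn_const hvol)
    _ = ε⁻¹ * volume.real (thickening ε A \ A) := by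
        rw [integral_indicator hmeas, setIntegral_const, smul_eq_mul, mul_comm]

/-- The perimeter is bounded by the outer Minkowski content. -/
theorem perimeter_le_of_volume_thickening {A : Set (EuclideanSpace ℝ (Fin d))}
    (hA : MeasurableSet A) (hcl : volume (closure A \ A) = 0) {c D : ℝ} (hc0 : 0 ≤ c) (hD : 0 ≤ D)
    (hc : ∀ ε, 0 < ε → volume (thickening ε A \ A) ≤ ENNReal.ofReal (ε * (c + D * ε))) :
    perimeter A ≤ ENNReal.ofReal c := by
  refine perimeter_le hA fun z hz => ENNReal.ofReal_le_ofReal ?_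
  set e : ℕ → ℝ := fun n => 1 / ((n : ℝ) + 1) with he
  have hepos (n) : 0 < e n := Nat.one_div_pos_of_nat
  have helim : Tendsto e atTop (𝓝 0) := tendsto_one_div_add_atTop_nhds_zero_nat
  -- The thickened indicators converge to the indicator of the closure, not of `A`.
  have hae : A =ᵐ[volume] closure A := by
    refine (subset_closure.eventuallyLE).antisymm ?_
    exact ae_le_set.2 hcl
  have hlim : Tendsto (fun n => ∫ x, (thickenedIndicator (hepos n) A x : ℝ) * divergence z x) atTop
      (𝓝 (∫ x in A, divergence z x)) := by
    rw [setIntegral_congr_set hae, ← integral_indicator_mul_divergence isClosed_closure.measurableSet]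
    refine tendsto_integral_of_dominated_convergence (fun x => ‖divergence z x‖) (fun n => ?_)
      (integrable_divergence hz).norm (fun n => .of_forall fun x => ?_) (.of_forall fun x => ?_)
    · refine Continuous.aestronglyMeasurable ?_
      have := continuous_divergence hz
      have := (thickenedIndicator (hepos n) A).continuous
      fun_prop
    · rw [norm_mul]
      refine mul_le_of_le_one_left (norm_nonneg _) ?_
      simpa using thickenedIndicator_le_one (hepos n) A x
    · refine Tendsto.mul_const _ ?_
      have := tendsto_pi_nhds.1 (thickenedIndicator_tendsto_indicator_closure hepos helim A) x
      have h2 := (NNReal.tendsto_coe.2 this)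
      convert h2 using 2
      by_cases hx : x ∈ closure A <;> simp [hx]
  have hlim2 : Tendsto (fun n => c + D * e n) atTop (𝓝 c) := by
    simpa using tendsto_const_nhds.add (helim.const_mul D)
  refine le_of_tendsto_of_tendsto' hlim hlim2 fun n => ?_
  have hn := hepos n
  refine (integral_thickenedIndicator_mul_divergence_le hn
    ((hc _ hn).trans_lt ENNReal.ofReal_lt_top).ne hA hz).trans ?_
  rw [inv_mul_le_iff₀ hn]
  exact ENNReal.toReal_le_of_le_ofReal (by positivity) (hc _ hn)

end

/-! ### Lipschitz and non-compactly supported fields as tests for the perimeter. -/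

section

variable {d : ℕ}

lemma measurable_divergence {v : EuclideanSpace ℝ (Fin d) → EuclideanSpace ℝ (Fin d)} :
    Measurable (divergence v) := by
  have h := measurable_fderiv ℝ v
  unfold divergence
  refine Finset.measurable_sum _ fun i _ => ?_
  exact (EuclideanSpace.proj (𝕜 := ℝ) i).measurable.comp (h.apply_continuousLinearMap _)

lemma norm_divergence_le {v : EuclideanSpace ℝ (Fin d) → EuclideanSpace ℝ (Fin d)} {C : ℝ≥0}
    (hv : LipschitzWith C v) (x : EuclideanSpace ℝ (Fin d)) : ‖divergence v x‖ ≤ d * C := by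
  calc ‖divergence v x‖ ≤ ∑ i : Fin d, ‖fderiv ℝ v x (EuclideanSpace.single i 1) i‖ :=
        norm_sum_le _ _
    _ ≤ ∑ _i : Fin d, (C : ℝ) := by
        refine Finset.sum_le_sum fun i _ => ?_
        refine (PiLp.norm_apply_le _ i).trans (((fderiv ℝ v x).le_opNorm _).trans ?_)
        simpa using norm_fderiv_le_of_lipschitz ℝ hv (x₀ := x)
    _ = d * C := by simp

/-- The divergence of a mollified Lipschitz field is the mollified divergence. -/
theorem divergence_convolution {v : EuclideanSpace ℝ (Fin d) → EuclideanSpace ℝ (Fin d)}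
    {C : ℝ≥0} (hv : LipschitzWith C v) {φ : EuclideanSpace ℝ (Fin d) → ℝ} (hφ : Continuous φ)
    (hφs : HasCompactSupport φ) (x : EuclideanSpace ℝ (Fin d)) :
    divergence (φ ⋆[ContinuousLinearMap.lsmul ℝ ℝ, volume] v) x
      = (φ ⋆[ContinuousLinearMap.lsmul ℝ ℝ, volume] divergence v) x := by
  have hvc := hv.continuous
  have hφi : Integrable φ := hφ.integrable_of_hasCompactSupport hφs
  have hmp : MeasurePreserving (fun t : EuclideanSpace ℝ (Fin d) => x - t) volume volume :=
    Measure.measurePreserving_sub_left volume x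
  -- The derivative is put on `v`, not on `φ`; the Lipschitz bound makes differentiability of `v` at
  -- almost every `x - t` sufficient.
  have key := hasFDerivAt_integral_of_dominated_loc_of_lip (𝕜 := ℝ) (μ := volume)
    (F := fun y t => φ t • v (y - t)) (F' := fun t => φ t • fderiv ℝ v (x - t)) (x₀ := x)
    (s := univ) (bound := fun t => ‖φ t‖ * C) univ_mem
    (.of_forall fun y => Continuous.aestronglyMeasurable (by fun_prop))
    (Continuous.integrable_of_hasCompactSupport (by fun_prop) (hφs.smul_right))
    ((hφ.aestronglyMeasurable).smul
      ((measurable_fderiv ℝ v).comp (measurable_const_sub x)).aestronglyMeasurable)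
    (.of_forall fun t => by
      refine (LipschitzWith.of_dist_le_mul fun y y' => ?_).lipschitzOnWith
      rw [dist_smul₀, Real.coe_nnabs, abs_mul, abs_norm, NNReal.abs_eq, mul_assoc]
      gcongr
      simpa using hv.dist_le_mul (y - t) (y' - t))
    (hφi.norm.mul_const _)
    (by
      filter_upwards [hmp.quasiMeasurePreserving.ae hv.ae_differentiableAt] with t ht
      have h1 : HasFDerivAt (fun y => y - t) (ContinuousLinearMap.id ℝ _) x :=
        (hasFDerivAt_id x).sub_const t
      have h2 := (HasFDerivAt.comp (f := fun y => y - t) x ht.hasFDerivAt h1).const_smul (φ t)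
      rw [ContinuousLinearMap.comp_id] at h2
      exact h2)
  have hint (i : Fin d) : Integrable fun t => φ t * fderiv ℝ v (x - t) (EuclideanSpace.single i 1) i := by
    have := (key.1.apply_continuousLinearMap (EuclideanSpace.single i 1))
    simpa using (EuclideanSpace.proj (𝕜 := ℝ) i).integrable_comp this
  simp only [divergence, convolution, ContinuousLinearMap.lsmul_apply, smul_eq_mul, Finset.mul_sum]
  have hfd : fderiv ℝ (φ ⋆[ContinuousLinearMap.lsmul ℝ ℝ, volume] v) x
      = ∫ t, φ t • fderiv ℝ v (x - t) := key.2.fderiv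
  rw [integral_finsetSum _ fun i _ => hint i, hfd]
  refine Finset.sum_congr rfl fun i _ => ?_
  rw [ContinuousLinearMap.integral_apply key.1]
  have := (EuclideanSpace.proj (𝕜 := ℝ) i).integral_comp_comm
    (key.1.apply_continuousLinearMap (EuclideanSpace.single i 1))
  simpa using this.symm

/-- Compactly supported Lipschitz fields of norm at most one may be used to test the perimeter. -/
theorem le_perimeter_of_lipschitzWith {F : Set (EuclideanSpace ℝ (Fin d))} (hF : MeasurableSet F)
    {v : EuclideanSpace ℝ (Fin d) → EuclideanSpace ℝ (Fin d)} {C : ℝ≥0} (hv : LipschitzWith C v)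
    (hvs : HasCompactSupport v) (hv1 : ∀ x, ‖v x‖ ≤ 1) :
    ENNReal.ofReal (∫ x in F, divergence v x) ≤ perimeter F := by
  -- The ratio 2 of the radii stays bounded, as almost everywhere convergence of the mollifications
  -- requires.
  let φ : ℕ → ContDiffBump (0 : EuclideanSpace ℝ (Fin d)) := fun n =>
    ⟨1 / ((n : ℝ) + 1) / 2, 1 / ((n : ℝ) + 1), by positivity, half_lt_self (by positivity)⟩
  set z : ℕ → EuclideanSpace ℝ (Fin d) → EuclideanSpace ℝ (Fin d) := fun n =>
    ((φ n).normed volume ⋆[ContinuousLinearMap.lsmul ℝ ℝ, volume] v) with hz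
  have hli : LocallyIntegrable (divergence v) volume := by
    refine MemLp.locallyIntegrable (p := ⊤) ?_ le_top
    exact memLp_top_of_bound measurable_divergence.aestronglyMeasurable _
      (.of_forall (norm_divergence_le hv))
  have hdiv (n x) : divergence (z n) x =
      ((φ n).normed volume ⋆[ContinuousLinearMap.lsmul ℝ ℝ, volume] divergence v) x :=
    divergence_convolution hv (φ n).continuous_normed (φ n).hasCompactSupport_normed x
  have hbound (n x) : ‖z n x‖ ≤ 1 := by
    refine (norm_integral_le_of_norm_le ((φ n).integrable_normed (μ := volume))
      (.of_forall fun t => ?_)).trans ((φ n).integral_normed (μ := volume)).le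
    rw [ContinuousLinearMap.lsmul_apply, norm_smul, Real.norm_of_nonneg ((φ n).nonneg_normed t)]
    exact mul_le_of_le_one_right ((φ n).nonneg_normed t) (hv1 _)
  have hmem (n) : z n ∈ testFields d :=
    ⟨(φ n).hasCompactSupport_normed.contDiff_convolution_left _ (φ n).contDiff_normed
      hv.continuous.locallyIntegrable, (φ n).hasCompactSupport_normed.convolution _ hvs, hbound n⟩
  have hdbound (n x) : ‖divergence (z n) x‖ ≤ d * C := by
    rw [hdiv]
    have h1 : Integrable fun t => (φ n).normed volume t * (d * C : ℝ) :=
      ((φ n).integrable_normed (μ := volume)).mul_const _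
    refine (norm_integral_le_of_norm_le h1 (.of_forall fun t => ?_)).trans ?_
    · rw [ContinuousLinearMap.lsmul_apply, norm_smul, Real.norm_of_nonneg ((φ n).nonneg_normed t)]
      exact mul_le_mul_of_nonneg_left (norm_divergence_le hv _) ((φ n).nonneg_normed t)
    · rw [integral_mul_const, (φ n).integral_normed, one_mul]
  obtain ⟨R, hR⟩ := hvs.isBounded.subset_closedBall (0 : EuclideanSpace ℝ (Fin d))
  -- All bumps have radius at most 1, so one ball contains every support and provides an integrable
  -- dominating function.
  have hsupp (n x) (hx : x ∉ closedBall (0 : EuclideanSpace ℝ (Fin d)) (R + 1)) :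
      divergence (z n) x = 0 := by
    rw [hdiv, convolution]
    refine integral_eq_zero_of_ae (.of_forall fun t => ?_)
    by_cases ht : (φ n).normed volume t = 0
    · simp [ht]
    · have ht' : t ∈ ball (0 : EuclideanSpace ℝ (Fin d)) (φ n).rOut := by
        rw [← (φ n).support_normed_eq (μ := volume)]; exact ht
      have h3 : ‖t‖ < 1 := by
        have : ‖t‖ < 1 / ((n : ℝ) + 1) := by simpa [φ] using ht'
        refine this.trans_le ?_
        rw [div_le_one (by positivity)]
        linarith [n.cast_nonneg (α := ℝ)]
      have h4 : x - t ∉ tsupport v := fun h => hx <| by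
        have h5 := hR h
        simp only [mem_closedBall, dist_zero_right] at h5 ⊢
        calc ‖x‖ = ‖(x - t) + t‖ := by simp
          _ ≤ ‖x - t‖ + ‖t‖ := norm_add_le _ _
          _ ≤ R + 1 := by linarith
      have h6 : divergence v (x - t) = 0 := by
        simp [divergence, fderiv_of_notMem_tsupport ℝ h4]
      simp [h6]
  have hlim : Tendsto (fun n => ∫ x in F, divergence (z n) x) atTop
      (𝓝 (∫ x in F, divergence v x)) := by
    refine tendsto_integral_of_dominated_convergence
      ((closedBall (0 : EuclideanSpace ℝ (Fin d)) (R + 1)).indicator fun _ => (d * C : ℝ))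
      (fun n => measurable_divergence.aestronglyMeasurable) ?_
      (fun n => .of_forall fun x => ?_) ?_
    · refine Integrable.integrableOn ?_
      exact (integrable_indicator_iff isClosed_closedBall.measurableSet).2
        (integrableOn_const measure_closedBall_lt_top.ne)
    · by_cases hx : x ∈ closedBall (0 : EuclideanSpace ℝ (Fin d)) (R + 1)
      · rw [indicator_of_mem hx]; exact hdbound n x
      · rw [indicator_of_notMem hx, hsupp n x hx, norm_zero]
    · refine ae_restrict_of_ae ?_
      have := ContDiffBump.ae_convolution_tendsto_right_of_locallyIntegrable (φ := φ) (l := atTop)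
        (K := 2) tendsto_one_div_add_atTop_nhds_zero_nat
        (.of_forall fun n => by simp only [φ]; linarith) hli
      filter_upwards [this] with x hx
      simpa only [hdiv] using hx
  exact le_of_tendsto' ((ENNReal.continuous_ofReal.tendsto _).comp hlim) fun n =>
    le_perimeter hF (hmem n)

lemma lipschitzWith_mul_of_norm_le {α : Type*} [PseudoMetricSpace α] {u w : α → ℝ}
    {C D M N : ℝ≥0}
    (hu : LipschitzWith C u) (hw : LipschitzWith D w) (hM : ∀ x, ‖u x‖ ≤ M)
    (hN : ∀ x, ‖w x‖ ≤ N) : LipschitzWith (M * D + C * N) fun x => u x * w x := by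
  refine LipschitzWith.of_dist_le_mul fun x y => ?_
  have h1 : u x * w x - u y * w y = u x * (w x - w y) + (u x - u y) * w y := by ring
  rw [dist_eq_norm, h1]
  have h2 : ‖u x - u y‖ ≤ C * dist x y := hu.dist_le_mul x y
  have h3 : ‖w x - w y‖ ≤ D * dist x y := hw.dist_le_mul x y
  calc ‖u x * (w x - w y) + (u x - u y) * w y‖
      ≤ ‖u x‖ * ‖w x - w y‖ + ‖u x - u y‖ * ‖w y‖ := by
        simpa only [norm_mul] using norm_add_le (u x * (w x - w y)) ((u x - u y) * w y)
    _ ≤ M * (D * dist x y) + (C * dist x y) * N := by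
        gcongr
        · exact hM x
        · exact hN y
    _ = _ := by push_cast; ring

/-- The factor `x` is unbounded, but one of the two points may be assumed to lie in the ball of
radius `R`, and the difference of `u` is multiplied by that point. -/
lemma lipschitzWith_smul_id {u : EuclideanSpace ℝ (Fin d) → ℝ} {C M R : ℝ≥0}
    (hu : LipschitzWith C u) (hM : ∀ x, ‖u x‖ ≤ M) (hR : ∀ x, R < ‖x‖ → u x = 0) :
    LipschitzWith (M + C * R) fun x => u x • x := by
  have main (x y : EuclideanSpace ℝ (Fin d)) (hx : ‖x‖ ≤ R) :
      dist (u x • x) (u y • y) ≤ (M + C * R) * dist x y := by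
    have h1 : u x • x - u y • y = u y • (x - y) + (u x - u y) • x := by module
    rw [dist_eq_norm, h1]
    have h2 := hu.norm_sub_le x y
    calc ‖u y • (x - y) + (u x - u y) • x‖ ≤ ‖u y‖ * ‖x - y‖ + ‖u x - u y‖ * ‖x‖ := by
          simpa only [norm_smul] using norm_add_le (u y • (x - y)) ((u x - u y) • x)
      _ ≤ M * ‖x - y‖ + (C * ‖x - y‖) * R := by
          gcongr
          exact hM y
      _ = (M + C * R) * dist x y := by rw [dist_eq_norm]; ring
  refine LipschitzWith.of_dist_le_mul fun x y => ?_
  push_cast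
  rcases le_or_gt ‖x‖ R with hx | hx
  · exact main x y hx
  rcases le_or_gt ‖y‖ R with hy | hy
  · rw [dist_comm, dist_comm x]
    exact main y x hy
  · simp only [hR x hx, hR y hy, zero_smul, dist_self]
    positivity

lemma divergence_smul_id {u : EuclideanSpace ℝ (Fin d) → ℝ} {x : EuclideanSpace ℝ (Fin d)}
    (hu : DifferentiableAt ℝ u x) :
    divergence (fun x => u x • x) x = d * u x + fderiv ℝ u x x := by
  have h := hu.hasFDerivAt.smul (hasFDerivAt_id x)
  have h2 : fderiv ℝ (fun x => u x • x) x = _ := h.fderiv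
  have h3 : fderiv ℝ u x x = ∑ i, x i * fderiv ℝ u x (EuclideanSpace.single i 1) := by
    have h4 := congrArg (fderiv ℝ u x) ((EuclideanSpace.basisFun (Fin d) ℝ).sum_repr x)
    simpa using h4.symm
  simp [divergence, h2, h3, Finset.sum_add_distrib, mul_comm]

/-- A Lipschitz cutoff function which is one on the ball of radius `R` and zero outside the ball
of radius `2 * R`. -/
def cutoff (d : ℕ) (R : ℝ) (x : EuclideanSpace ℝ (Fin d)) : ℝ := max 0 (min 1 (2 - R⁻¹ * ‖x‖))

lemma cutoff_nonneg (R : ℝ) (x : EuclideanSpace ℝ (Fin d)) : 0 ≤ cutoff d R x := le_max_left _ _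

lemma cutoff_le_one (R : ℝ) (x : EuclideanSpace ℝ (Fin d)) : cutoff d R x ≤ 1 :=
  max_le zero_le_one (min_le_left _ _)

lemma norm_cutoff_le (R : ℝ) (x : EuclideanSpace ℝ (Fin d)) : ‖cutoff d R x‖ ≤ 1 := by
  rw [Real.norm_of_nonneg (cutoff_nonneg R x)]
  exact cutoff_le_one R x

lemma cutoff_eq_one {R : ℝ} (hR : 0 < R) {x : EuclideanSpace ℝ (Fin d)} (hx : ‖x‖ ≤ R) :
    cutoff d R x = 1 := by
  have : R⁻¹ * ‖x‖ ≤ 1 := by rwa [inv_mul_le_iff₀ hR, mul_one]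
  rw [cutoff, min_eq_left (by linarith), max_eq_right zero_le_one]

lemma cutoff_eq_zero {R : ℝ} (hR : 0 < R) {x : EuclideanSpace ℝ (Fin d)} (hx : 2 * R ≤ ‖x‖) :
    cutoff d R x = 0 := by
  have : 2 ≤ R⁻¹ * ‖x‖ := by rw [inv_mul_eq_div, le_div_iff₀ hR]; exact hx
  rw [cutoff, max_eq_left]
  exact (min_le_right _ _).trans (by linarith)

lemma lipschitzWith_cutoff (d : ℕ) {R : ℝ} (hR : 0 < R) :
    LipschitzWith (R⁻¹).toNNReal (cutoff d R) := by
  have h : LipschitzWith (R⁻¹).toNNReal fun x : EuclideanSpace ℝ (Fin d) => 2 - R⁻¹ * ‖x‖ := by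
    refine LipschitzWith.of_dist_le_mul fun x y => ?_
    rw [Real.coe_toNNReal _ (by positivity), dist_sub_left, Real.dist_eq, ← mul_sub, abs_mul,
      abs_of_pos (inv_pos.2 hR), dist_eq_norm]
    gcongr
    exact abs_norm_sub_norm_le x y
  exact (h.const_min 1).const_max 0

lemma fderiv_cutoff_self {R : ℝ} (hR : 0 < R) {x : EuclideanSpace ℝ (Fin d)} (hx : ‖x‖ ≤ R) :
    fderiv ℝ (cutoff d R) x x = 0 := by
  rw [IsLocalMax.fderiv_eq_zero]
  · rfl
  · exact .of_forall fun y => by rw [cutoff_eq_one hR hx]; exact cutoff_le_one R y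

/-- The slope `1 / R` is met only where `‖x‖ ≤ 2 * R`. The bound does not depend on `R`, which is
what dominated convergence needs when the cutoff is removed. -/
lemma norm_fderiv_cutoff_self_le {R : ℝ} (hR : 0 < R) (x : EuclideanSpace ℝ (Fin d)) :
    ‖fderiv ℝ (cutoff d R) x x‖ ≤ 2 := by
  rcases le_total ‖x‖ (2 * R) with hx | hx
  · calc ‖fderiv ℝ (cutoff d R) x x‖ ≤ ‖fderiv ℝ (cutoff d R) x‖ * ‖x‖ :=
          (fderiv ℝ (cutoff d R) x).le_opNorm x
      _ ≤ R⁻¹ * (2 * R) := by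
          gcongr
          simpa [hR.le] using norm_fderiv_le_of_lipschitz ℝ (lipschitzWith_cutoff d hR) (x₀ := x)
      _ = 2 := by field_simp
  · rw [IsLocalMin.fderiv_eq_zero]
    · simp
    · exact .of_forall fun y => by rw [cutoff_eq_zero hR hx]; exact cutoff_nonneg R y

/-- The field `x ↦ u x • x`, of norm at most one but not necessarily compactly supported, may be
used to test the perimeter. -/
theorem le_perimeter_of_smul_id {F : Set (EuclideanSpace ℝ (Fin d))} (hF : MeasurableSet F)
    {u g : EuclideanSpace ℝ (Fin d) → ℝ} {C M : ℝ≥0} (hu : LipschitzWith C u)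
    (hM : ∀ x, ‖u x‖ ≤ M) (h1 : ∀ x, ‖u x • x‖ ≤ 1) (hui : Integrable u) (hgi : Integrable g)
    (hg : ∀ᵐ x, g x = d * u x + fderiv ℝ u x x) :
    ENNReal.ofReal (∫ x in F, g x) ≤ perimeter F := by
  have hR (n : ℕ) : (0 : ℝ) < (n : ℝ) + 1 := by positivity
  set w : ℕ → EuclideanSpace ℝ (Fin d) → ℝ := fun n => cutoff d ((n : ℝ) + 1)
  have hwl (n) := lipschitzWith_cutoff d (hR n)
  set q : ℕ → EuclideanSpace ℝ (Fin d) → ℝ := fun n x => u x * w n x with hq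
  have hql (n) := lipschitzWith_mul_of_norm_le (N := 1) hu (hwl n) hM (norm_cutoff_le _)
  have hqM (n x) : ‖q n x‖ ≤ ‖u x‖ := by
    rw [norm_mul]
    exact mul_le_of_le_one_right (norm_nonneg _) (norm_cutoff_le _ _)
  have hq0 (n : ℕ) (x) (hx : (2 * ((n : ℝ≥0) + 1) : ℝ≥0) < ‖x‖) : q n x = 0 := by
    push_cast at hx
    simp [hq, w, cutoff_eq_zero (hR n) hx.le]
  have hvl (n) := lipschitzWith_smul_id (hql n) (fun x => (hqM n x).trans (hM x)) (hq0 n)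
  have hvs (n) : HasCompactSupport fun x => q n x • x := by
    refine HasCompactSupport.intro
      (isCompact_closedBall 0 ((2 * ((n : ℝ≥0) + 1) : ℝ≥0) : ℝ)) fun x hx => ?_
    rw [hq0 n x (by simpa using hx), zero_smul]
  have hv1 (n x) : ‖q n x • x‖ ≤ 1 := by
    refine le_trans ?_ (h1 x)
    rw [norm_smul, norm_smul]
    gcongr
    exact hqM n x
  -- The error made by the cutoff is its radial derivative times `u`: dominated by `2 * ‖u‖`, and
  -- zero at each point for large `n`.
  have hdiv (n) : ∀ᵐ x, divergence (fun x => q n x • x) x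
      = w n x * g x + u x * fderiv ℝ (w n) x x := by
    filter_upwards [hg, hu.ae_differentiableAt, (hwl n).ae_differentiableAt] with x hx hux hwx
    rw [divergence_smul_id (u := q n) (hux.mul hwx), hx]
    have : fderiv ℝ (q n) x = _ := (hux.hasFDerivAt.mul hwx.hasFDerivAt).fderiv
    rw [this]
    simp only [hq, add_apply, smul_apply, smul_eq_mul]
    ring
  have hlim : Tendsto (fun n => ∫ x in F, divergence (fun x => q n x • x) x) atTop
      (𝓝 (∫ x in F, g x)) := by
    refine tendsto_integral_of_dominated_convergence (fun x => ‖g x‖ + ‖u x‖ * 2)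
      (fun n => measurable_divergence.aestronglyMeasurable)
      (hgi.norm.add (hui.norm.mul_const 2)).integrableOn (fun n => ?_) ?_
    · filter_upwards [ae_restrict_of_ae (hdiv n)] with x hx
      rw [hx]
      refine (norm_add_le _ _).trans (add_le_add ?_ ?_)
      · rw [norm_mul]
        exact mul_le_of_le_one_left (norm_nonneg _) (norm_cutoff_le _ _)
      · rw [norm_mul]
        gcongr
        exact norm_fderiv_cutoff_self_le (hR n) x
    · filter_upwards [ae_restrict_of_ae (ae_all_iff.2 hdiv)] with x hx
      refine tendsto_const_nhds.congr' ?_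
      obtain ⟨N, hN⟩ := exists_nat_ge ‖x‖
      filter_upwards [eventually_ge_atTop N] with n hn
      have hxn : ‖x‖ ≤ (n : ℝ) + 1 := by
        have : (N : ℝ) ≤ n := by exact_mod_cast hn
        linarith
      rw [hx n, fderiv_cutoff_self (hR n) hxn]
      simp [w, cutoff_eq_one (hR n) hxn]
  exact le_of_tendsto' ((ENNReal.continuous_ofReal.tendsto _).comp hlim) fun n =>
    le_perimeter_of_lipschitzWith hF (hvl n) (hvs n) (hv1 n)

end

/-! ### The calibrating field of the annulus. -/

section

/-- Bounded Lipschitz functions. -/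
def BoundedLipschitz {α : Type*} [PseudoMetricSpace α] (f : α → ℝ) : Prop :=
  ∃ C M : ℝ≥0, LipschitzWith C f ∧ ∀ x, ‖f x‖ ≤ M

namespace BoundedLipschitz

variable {α β : Type*} [PseudoMetricSpace α] [PseudoMetricSpace β] {f g : α → ℝ}

lemma const (c : ℝ) : BoundedLipschitz fun _ : α => c :=
  ⟨0, ‖c‖₊, LipschitzWith.const c, fun _ => le_rfl⟩

lemma mul (hf : BoundedLipschitz f) (hg : BoundedLipschitz g) :
    BoundedLipschitz fun x => f x * g x := by
  obtain ⟨C, M, hf, hM⟩ := hf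
  obtain ⟨D, N, hg, hN⟩ := hg
  refine ⟨_, M * N, lipschitzWith_mul_of_norm_le hf hg hM hN, fun x => ?_⟩
  rw [norm_mul]
  push_cast
  gcongr
  exacts [hM x, hN x]

lemma add (hf : BoundedLipschitz f) (hg : BoundedLipschitz g) :
    BoundedLipschitz fun x => f x + g x := by
  obtain ⟨C, M, hf, hM⟩ := hf
  obtain ⟨D, N, hg, hN⟩ := hg
  exact ⟨_, M + N, hf.add hg, fun x => (norm_add_le _ _).trans (add_le_add (hM x) (hN x))⟩

lemma pow (hf : BoundedLipschitz f) (n : ℕ) : BoundedLipschitz fun x => f x ^ n := by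
  induction n with
  | zero => simpa using const 1
  | succ n ih => simpa only [pow_succ] using ih.mul hf

lemma comp (hf : BoundedLipschitz f) {φ : β → α} {K : ℝ≥0} (hφ : LipschitzWith K φ) :
    BoundedLipschitz fun x => f (φ x) := by
  obtain ⟨C, M, hf, hM⟩ := hf
  exact ⟨_, M, hf.comp hφ, fun x => hM _⟩

lemma inv_max {a : ℝ} (ha : 0 < a) : BoundedLipschitz fun t : ℝ => (max a t)⁻¹ := by
  have hpos (t : ℝ) : 0 < max a t := lt_max_of_lt_left ha
  refine ⟨((a ^ 2)⁻¹).toNNReal, (a⁻¹).toNNReal, ?_, fun t => ?_⟩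
  · refine LipschitzWith.of_dist_le_mul fun s t => ?_
    rw [Real.coe_toNNReal _ (by positivity), Real.dist_eq, inv_sub_inv (hpos s).ne' (hpos t).ne',
      abs_div, abs_of_pos (mul_pos (hpos s) (hpos t)), div_eq_inv_mul, abs_sub_comm]
    gcongr
    · rw [pow_two]
      gcongr <;> exact le_max_left _ _
    · simpa [Real.dist_eq] using ((LipschitzWith.id (α := ℝ)).const_max a).dist_le_mul s t
  · rw [Real.coe_toNNReal _ (by positivity), Real.norm_of_nonneg (by simpa using (hpos t).le)]
    exact inv_anti₀ ha (le_max_left _ _)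

end BoundedLipschitz

/-- The radial profile of the field `x ↦ profile r₁ r₂ ‖x‖ • x` which calibrates the annulus. -/
def profile (r₁ r₂ r : ℝ) : ℝ :=
  (1 - r₁ * r₂ / (max r₁ (min r₂ r)) ^ 2) / (r₂ - r₁) + (r₂ ^ 2 / (max r₂ r) ^ 3 - 1 / r₂)

variable {r₁ r₂ r : ℝ}

lemma profile_of_le_left (h₁ : 0 < r₁) (hr : r₁ < r₂) (h : r ≤ r₁) : profile r₁ r₂ r = -1 / r₁ := by
  have h₂ : 0 < r₂ := h₁.trans hr
  have h3 : r₂ - r₁ ≠ 0 := (sub_pos.2 hr).ne'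
  rw [profile, max_eq_left (h.trans hr.le), max_eq_left (by rw [min_eq_right] <;> linarith)]
  field_simp
  ring

lemma profile_of_mem_Icc (h₁ : 0 ≤ r₁) (hr : r₁ < r₂) (h : r₁ ≤ r) (h' : r ≤ r₂) :
    profile r₁ r₂ r = (1 - r₁ * r₂ / r ^ 2) / (r₂ - r₁) := by
  have h₂ : 0 < r₂ := h₁.trans_lt hr
  rw [profile, max_eq_left h', min_eq_right h', max_eq_right h]
  field_simp
  ring

lemma profile_of_le_right (h₁ : 0 ≤ r₁) (hr : r₁ < r₂) (h : r₂ ≤ r) :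
    profile r₁ r₂ r = r₂ ^ 2 / r ^ 3 := by
  have h₂ : 0 < r₂ := h₁.trans_lt hr
  have h3 : r₂ - r₁ ≠ 0 := (sub_pos.2 hr).ne'
  rw [profile, max_eq_right h, min_eq_left h, max_eq_right hr.le]
  field_simp
  ring

/-- Each summand of the profile is a polynomial in the inverse of a clamped radius, bounded away
from zero. For `r₁ = 0` the singular term has coefficient zero. -/
lemma boundedLipschitz_profile (h₁ : 0 ≤ r₁) (hr : r₁ < r₂) :
    BoundedLipschitz (profile r₁ r₂) := by
  have h₂ : 0 < r₂ := h₁.trans_lt hr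
  have hY : BoundedLipschitz fun r : ℝ => r₂ ^ 2 * (max r₂ r)⁻¹ ^ 3 + -(1 / r₂) :=
    ((BoundedLipschitz.const _).mul ((BoundedLipschitz.inv_max h₂).pow 3)).add (.const _)
  have hX : BoundedLipschitz fun r : ℝ =>
      (r₂ - r₁)⁻¹ + -(r₁ * r₂ / (r₂ - r₁)) * (max r₁ (min r₂ r))⁻¹ ^ 2 := by
    rcases h₁.eq_or_lt with rfl | h₁
    · simpa using BoundedLipschitz.const _
    · exact (BoundedLipschitz.const _).add ((BoundedLipschitz.const _).mul
        (((BoundedLipschitz.inv_max h₁).comp ((LipschitzWith.id (α := ℝ)).const_min r₂)).pow 2))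
  convert hX.add hY using 2 with r
  simp only [profile]
  ring

/-- The norm of the field: `r / r₁` inside and `(r₂ / r) ^ 2` outside; on the annulus the signed
radial component lies between `-1` and `1`. -/
lemma abs_profile_mul_le (h₁ : 0 ≤ r₁) (hr : r₁ < r₂) (hr0 : 0 ≤ r) :
    |profile r₁ r₂ r| * r ≤ 1 := by
  have h₂ : 0 < r₂ := h₁.trans_lt hr
  rcases hr0.eq_or_lt with rfl | hr0
  · simp
  rw [← abs_of_pos hr0, ← abs_mul, abs_of_pos hr0]
  rcases le_total r₁ r with h | h
  · rcases le_total r r₂ with h' | h'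
    · rw [profile_of_mem_Icc h₁ hr h h', div_mul_eq_mul_div, abs_div, abs_of_pos (sub_pos.2 hr),
        div_le_one (sub_pos.2 hr)]
      have : (1 - r₁ * r₂ / r ^ 2) * r = (r ^ 2 - r₁ * r₂) / r := by field_simp
      rw [this, abs_div, abs_of_pos hr0, div_le_iff₀ hr0, abs_le]
      -- The two bounds are `(r - r₁) * (r + r₂) ≥ 0` and `(r₂ - r) * (r + r₁) ≥ 0`.
      constructor <;> nlinarith [mul_nonneg (sub_nonneg.2 h) (by positivity : 0 ≤ r + r₂),
        mul_nonneg (sub_nonneg.2 h') (by positivity : 0 ≤ r + r₁)]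
    · rw [profile_of_le_right h₁ hr h']
      have : r₂ ^ 2 / r ^ 3 * r = (r₂ / r) ^ 2 := by field_simp
      rw [this, abs_of_nonneg (by positivity)]
      exact pow_le_one₀ (by positivity) ((div_le_one hr0).2 h')
  · have h₁' : 0 < r₁ := hr0.trans_le h
    rw [profile_of_le_left h₁' hr h]
    have : -1 / r₁ * r = -(r / r₁) := by ring
    rw [this, abs_neg, abs_of_nonneg (by positivity)]
    exact (div_le_one h₁').2 h

/-- The divergence of the field `x ↦ profile r₁ r₂ ‖x‖ • x`. -/
def annulusCurvature (r₁ r₂ : ℝ) (x : EuclideanSpace ℝ (Fin 2)) : ℝ :=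
  if ‖x‖ < r₁ then -(2 / r₁) else if ‖x‖ < r₂ then 2 / (r₂ - r₁) else -(r₂ ^ 2 / ‖x‖ ^ 3)

lemma measurable_annulusCurvature : Measurable (annulusCurvature r₁ r₂) := by
  refine Measurable.ite (measurableSet_lt measurable_norm measurable_const) measurable_const ?_
  refine Measurable.ite (measurableSet_lt measurable_norm measurable_const) measurable_const ?_
  fun_prop

lemma mem_annulus {x : EuclideanSpace ℝ (Fin 2)} : x ∈ annulus r₁ r₂ ↔ r₁ ≤ ‖x‖ ∧ ‖x‖ < r₂ := by
  simp [annulus, and_comm]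

lemma measurableSet_annulus : MeasurableSet (annulus r₁ r₂) :=
  measurableSet_ball.diff measurableSet_ball

lemma annulusCurvature_of_mem {x : EuclideanSpace ℝ (Fin 2)} (hx : x ∈ annulus r₁ r₂) :
    annulusCurvature r₁ r₂ x = 2 / (r₂ - r₁) := by
  rw [mem_annulus] at hx
  rw [annulusCurvature, if_neg hx.1.not_gt, if_pos hx.2]

lemma annulusCurvature_neg_of_notMem (h₁ : 0 ≤ r₁) (hr : r₁ < r₂) {x : EuclideanSpace ℝ (Fin 2)}
    (hx : x ∉ annulus r₁ r₂) : annulusCurvature r₁ r₂ x < 0 := by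
  have h₂ : 0 < r₂ := h₁.trans_lt hr
  rw [annulusCurvature]
  split_ifs with h h'
  · have : 0 < r₁ := (norm_nonneg x).trans_lt h
    simp [this]
  · exact absurd (mem_annulus.2 ⟨not_lt.1 h, h'⟩) hx
  · have : 0 < ‖x‖ := h₂.trans_le (not_lt.1 h')
    simp only [neg_lt_zero]
    positivity

/-- Comparison with `(1 + ‖x‖) ^ (-3)`, integrable because 3 exceeds the dimension. It serves both
the profile and the curvature. -/
lemma integrable_of_cubic_decay (h₂ : 0 < r₂) {f : EuclideanSpace ℝ (Fin 2) → ℝ}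
    (hf : AEStronglyMeasurable f) {M : ℝ} (hM : ∀ x, ‖x‖ ≤ r₂ → ‖f x‖ ≤ M)
    (hd : ∀ x, r₂ ≤ ‖x‖ → ‖f x‖ ≤ r₂ ^ 2 / ‖x‖ ^ 3) : Integrable f := by
  have hM0 : 0 ≤ M := (norm_nonneg _).trans (hM 0 (by simpa using h₂.le))
  have hi : Integrable fun x : EuclideanSpace ℝ (Fin 2) => (1 + ‖x‖) ^ (-(3 : ℝ)) :=
    integrable_one_add_norm (by norm_num)
  refine (hi.const_mul ((M + r₂⁻¹) * (1 + r₂) ^ 3)).mono' hf (.of_forall fun x => ?_)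
  have h0 := norm_nonneg x
  rw [Real.rpow_neg (by positivity)]
  norm_cast
  rw [mul_assoc, ← div_eq_mul_inv, ← div_pow]
  rcases le_total ‖x‖ r₂ with h | h
  · calc ‖f x‖ ≤ M * 1 := by rw [mul_one]; exact hM x h
      _ ≤ (M + r₂⁻¹) * ((1 + r₂) / (1 + ‖x‖)) ^ 3 := by
        gcongr
        · have := inv_pos.2 h₂
          linarith
        · refine one_le_pow₀ ?_
          rw [one_le_div (by positivity)]
          linarith
  · have hx : 0 < ‖x‖ := h₂.trans_le h
    calc ‖f x‖ ≤ r₂ ^ 2 / ‖x‖ ^ 3 := hd x h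
      _ = r₂⁻¹ * (r₂ / ‖x‖) ^ 3 := by field_simp
      _ ≤ (M + r₂⁻¹) * ((1 + r₂) / (1 + ‖x‖)) ^ 3 := by
        have : r₂ / ‖x‖ ≤ (1 + r₂) / (1 + ‖x‖) := by
          rw [div_le_div_iff₀ hx (by positivity)]
          linarith
        gcongr
        linarith

lemma integrable_annulusCurvature (h₁ : 0 ≤ r₁) (hr : r₁ < r₂) :
    Integrable (annulusCurvature r₁ r₂) := by
  have h₂ : 0 < r₂ := h₁.trans_lt hr
  have h3 : 0 < r₂ - r₁ := sub_pos.2 hr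
  refine integrable_of_cubic_decay h₂ measurable_annulusCurvature.aestronglyMeasurable
    (M := 2 / r₁ + 2 / (r₂ - r₁) + 1 / r₂) (fun x hx => ?_) (fun x hx => ?_)
  · have e1 : 0 ≤ 2 / r₁ := by positivity
    have e2 : 0 ≤ 2 / (r₂ - r₁) := by positivity
    have e3 : 0 ≤ 1 / r₂ := by positivity
    rw [annulusCurvature]
    split_ifs with h h'
    · rw [norm_neg, Real.norm_of_nonneg e1]
      linarith
    · rw [Real.norm_of_nonneg e2]
      linarith
    · rw [le_antisymm hx (not_lt.1 h'), norm_neg, Real.norm_of_nonneg (by positivity)]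
      have : r₂ ^ 2 / r₂ ^ 3 = 1 / r₂ := by field_simp
      linarith
  · rw [annulusCurvature, if_neg (by linarith), if_neg (by linarith), norm_neg,
      Real.norm_of_nonneg (by positivity)]

lemma hasDerivAt_profile (h₁ : 0 ≤ r₁) (hr : r₁ < r₂) {x : EuclideanSpace ℝ (Fin 2)} (h0 : x ≠ 0)
    (hx₁ : ‖x‖ ≠ r₁) (hx₂ : ‖x‖ ≠ r₂) :
    ∃ D, HasDerivAt (profile r₁ r₂) D ‖x‖ ∧
      annulusCurvature r₁ r₂ x = 2 * profile r₁ r₂ ‖x‖ + D * ‖x‖ := by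
  have h₂ : 0 < r₂ := h₁.trans_lt hr
  have h3 : r₂ - r₁ ≠ 0 := (sub_pos.2 hr).ne'
  have hx : 0 < ‖x‖ := norm_pos_iff.2 h0
  rcases lt_or_gt_of_ne hx₁ with h | h
  · have h₁' : 0 < r₁ := hx.trans h
    refine ⟨0, (hasDerivAt_const ‖x‖ (-1 / r₁)).congr_of_eventuallyEq ?_, ?_⟩
    · filter_upwards [Iio_mem_nhds h] with r hr'
      exact profile_of_le_left h₁' hr (le_of_lt hr')
    · rw [annulusCurvature, if_pos h, profile_of_le_left h₁' hr h.le]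
      ring
  rcases lt_or_gt_of_ne hx₂ with h' | h'
  · have hd : HasDerivAt (fun r : ℝ => (1 - r₁ * r₂ / r ^ 2) / (r₂ - r₁))
        (2 * (r₁ * r₂) / ‖x‖ ^ 3 / (r₂ - r₁)) ‖x‖ := by
      have := (((hasDerivAt_const ‖x‖ (r₁ * r₂)).div (hasDerivAt_pow 2 ‖x‖)
        (by positivity)).const_sub 1).div_const (r₂ - r₁)
      refine this.congr_deriv ?_
      field_simp
      norm_num
      ring
    refine ⟨_, hd.congr_of_eventuallyEq ?_, ?_⟩
    · filter_upwards [Ioo_mem_nhds h h'] with r hr'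
      exact profile_of_mem_Icc h₁ hr hr'.1.le hr'.2.le
    · rw [annulusCurvature, if_neg h.not_gt, if_pos h', profile_of_mem_Icc h₁ hr h.le h'.le]
      field_simp
      ring
  · have hd : HasDerivAt (fun r : ℝ => r₂ ^ 2 / r ^ 3) (-(3 * r₂ ^ 2) / ‖x‖ ^ 4) ‖x‖ := by
      have := (hasDerivAt_const ‖x‖ (r₂ ^ 2)).div (hasDerivAt_pow 3 ‖x‖) (by positivity)
      refine this.congr_deriv ?_
      field_simp
      norm_num
      ring
    refine ⟨_, hd.congr_of_eventuallyEq ?_, ?_⟩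
    · filter_upwards [Ioi_mem_nhds h'] with r hr'
      exact profile_of_le_right h₁ hr (le_of_lt hr')
    · rw [annulusCurvature, if_neg h.not_gt, if_neg h'.not_gt, profile_of_le_right h₁ hr h'.le]
      field_simp
      ring

lemma annulusCurvature_ae_eq (h₁ : 0 ≤ r₁) (hr : r₁ < r₂) :
    ∀ᵐ x : EuclideanSpace ℝ (Fin 2), annulusCurvature r₁ r₂ x = 2 * profile r₁ r₂ ‖x‖
      + fderiv ℝ (fun x => profile r₁ r₂ ‖x‖) x x := by
  have hs (r : ℝ) : ∀ᵐ x : EuclideanSpace ℝ (Fin 2), ‖x‖ ≠ r := by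
    have := Measure.addHaar_sphere (volume : Measure (EuclideanSpace ℝ (Fin 2))) 0 r
    rw [ae_iff]
    convert this using 2
    ext x
    simp
  filter_upwards [hs 0, hs r₁, hs r₂] with x hx0 hx₁ hx₂
  have h0 : x ≠ 0 := norm_ne_zero_iff.1 hx0
  obtain ⟨D, hD, hx⟩ := hasDerivAt_profile h₁ hr h0 hx₁ hx₂
  have hn : DifferentiableAt ℝ (fun x : EuclideanSpace ℝ (Fin 2) => ‖x‖) x :=
    differentiableAt_id.norm ℝ h0
  have h4 : fderiv ℝ (fun x : EuclideanSpace ℝ (Fin 2) => profile r₁ r₂ ‖x‖) x = _ :=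
    (hD.comp_hasFDerivAt x hn.hasFDerivAt).fderiv
  rw [hx, h4]
  simp [hn.fderiv_norm_self]

/-- The annulus is calibrated by the field with divergence `annulusCurvature`. -/
theorem abs_integral_annulusCurvature_le (h₁ : 0 ≤ r₁) (hr : r₁ < r₂)
    {F : Set (EuclideanSpace ℝ (Fin 2))} (hF : FinitePerimeter F) :
    |∫ x in F, annulusCurvature r₁ r₂ x| ≤ (perimeter F).toReal := by
  have h₂ : 0 < r₂ := h₁.trans_lt hr
  obtain ⟨C, M, hC, hM⟩ := (boundedLipschitz_profile h₁ hr).comp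
    (lipschitzWith_one_norm (E := EuclideanSpace ℝ (Fin 2)))
  have hle (x : EuclideanSpace ℝ (Fin 2)) : ‖profile r₁ r₂ ‖x‖ • x‖ ≤ 1 := by
    rw [norm_smul]
    exact abs_profile_mul_le h₁ hr (norm_nonneg x)
  have hi : Integrable fun x : EuclideanSpace ℝ (Fin 2) => profile r₁ r₂ ‖x‖ :=
    integrable_of_cubic_decay h₂ hC.continuous.aestronglyMeasurable (fun x _ => hM x)
      fun x hx => by
        rw [profile_of_le_right h₁ hr hx, Real.norm_of_nonneg (by positivity)]
  have hκ := integrable_annulusCurvature h₁ hr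
  have hae := annulusCurvature_ae_eq h₁ hr
  have A : ENNReal.ofReal (∫ x in F, annulusCurvature r₁ r₂ x) ≤ perimeter F :=
    le_perimeter_of_smul_id hF.1 hC hM hle hi hκ (by simpa using hae)
  -- The opposite field gives the other sign, needed for the complement.
  have B : ENNReal.ofReal (∫ x in F, -annulusCurvature r₁ r₂ x) ≤ perimeter F := by
    refine le_perimeter_of_smul_id (u := fun x => -profile r₁ r₂ ‖x‖) hF.1 hC.neg
      (by simpa using hM) (by simpa using hle) hi.neg hκ.neg ?_
    filter_upwards [hae] with x hx
    rw [hx, fderiv_fun_neg]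
    simp
    ring
  rw [integral_neg] at B
  rw [ENNReal.ofReal_le_iff_le_toReal hF.2.ne] at A B
  exact abs_le.2 ⟨by linarith, A⟩

/-! ### Perimeter of the annulus. -/

lemma volume_real_ball {s : ℝ} (hs : 0 ≤ s) :
    volume.real (ball (0 : EuclideanSpace ℝ (Fin 2)) s) = s ^ 2 * Real.pi := by
  simp [Measure.real, EuclideanSpace.volume_ball_fin_two, hs, Real.pi_pos.le]

lemma volume_real_annulus (h₁ : 0 ≤ r₁) (hr : r₁ < r₂) :
    volume.real (annulus r₁ r₂) = (r₂ ^ 2 - r₁ ^ 2) * Real.pi := by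
  rw [annulus, measureReal_sdiff (ball_subset_ball hr.le) measurableSet_ball,
    volume_real_ball (h₁.trans hr.le), volume_real_ball h₁]
  ring

/-- The `ε`-shell lies in two thin rings, of area at most `π(2 r₂ ε + ε ^ 2)` and `2π r₁ ε`; the
first-order coefficient is the bound. -/
lemma perimeter_annulus_le (h₁ : 0 ≤ r₁) (hr : r₁ < r₂) :
    perimeter (annulus r₁ r₂) ≤ ENNReal.ofReal (2 * Real.pi * (r₁ + r₂)) := by
  have h₂ : 0 < r₂ := h₁.trans_lt hr
  have hπ := Real.pi_pos
  refine perimeter_le_of_volume_thickening measurableSet_annulus ?_ (by positivity) hπ.le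
    fun ε hε => ?_
  · refine measure_mono_null ?_
      (Measure.addHaar_sphere (volume : Measure (EuclideanSpace ℝ (Fin 2))) 0 r₂)
    rintro x ⟨hx, hx'⟩
    have hcl : closure (annulus r₁ r₂) ⊆ {x | r₁ ≤ ‖x‖ ∧ ‖x‖ ≤ r₂} := by
      refine closure_minimal (fun y hy => ?_) ?_
      · exact ⟨(mem_annulus.1 hy).1, (mem_annulus.1 hy).2.le⟩
      · exact (isClosed_le continuous_const continuous_norm).inter
          (isClosed_le continuous_norm continuous_const)
    have hx2 := hcl hx
    rw [mem_annulus, not_and, not_lt] at hx'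
    simpa using le_antisymm hx2.2 (hx' hx2.1)
  · have hsub : thickening ε (annulus r₁ r₂) \ annulus r₁ r₂ ⊆
        annulus r₂ (r₂ + ε) ∪ annulus (max 0 (r₁ - ε)) r₁ := by
      rintro x ⟨hx, hx'⟩
      obtain ⟨y, hy, hxy⟩ := mem_thickening_iff.1 hx
      rw [dist_eq_norm] at hxy
      rw [mem_annulus] at hy hx'
      have e1 := abs_lt.1 ((abs_norm_sub_norm_le x y).trans_lt hxy)
      rcases lt_or_ge ‖x‖ r₁ with h | h
      · exact Or.inr (mem_annulus.2 ⟨max_le (norm_nonneg x) (by linarith), h⟩)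
      · have h' : r₂ ≤ ‖x‖ := not_lt.1 fun h' => hx' ⟨h, h'⟩
        exact Or.inl (mem_annulus.2 ⟨h', by linarith⟩)
    have hfin (a b : ℝ) : volume (annulus a b) ≠ ⊤ :=
      ((measure_mono sdiff_subset).trans_lt measure_ball_lt_top).ne
    have hB : volume.real (annulus (max 0 (r₁ - ε)) r₁) ≤ 2 * ε * r₁ * Real.pi := by
      rcases h₁.eq_or_lt with rfl | h₁
      · have : annulus (max 0 (0 - ε)) 0 = ∅ := by simp [annulus]
        rw [this]
        simp
      · rw [volume_real_annulus (le_max_left _ _) (max_lt h₁ (by linarith))]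
        gcongr
        rcases le_total 0 (r₁ - ε) with h | h
        · rw [max_eq_right h]
          nlinarith
        · rw [max_eq_left h]
          nlinarith
    rw [← ENNReal.ofReal_toReal (ne_top_of_le_ne_top
      (measure_union_ne_top (hfin _ _) (hfin _ _)) (measure_mono hsub))]
    refine ENNReal.ofReal_le_ofReal ?_
    calc volume.real (thickening ε (annulus r₁ r₂) \ annulus r₁ r₂)
        ≤ volume.real (annulus r₂ (r₂ + ε)) + volume.real (annulus (max 0 (r₁ - ε)) r₁) :=
          (measureReal_mono hsub (measure_union_ne_top (hfin _ _) (hfin _ _))).trans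
            (measureReal_union_le _ _)
      _ ≤ ((r₂ + ε) ^ 2 - r₂ ^ 2) * Real.pi + 2 * ε * r₁ * Real.pi := by
          rw [volume_real_annulus h₂.le (by linarith)]
          gcongr
      _ = ε * (2 * Real.pi * (r₁ + r₂) + Real.pi * ε) := by ring

lemma finitePerimeter_annulus (h₁ : 0 ≤ r₁) (hr : r₁ < r₂) : FinitePerimeter (annulus r₁ r₂) :=
  ⟨measurableSet_annulus, (perimeter_annulus_le h₁ hr).trans_lt ENNReal.ofReal_lt_top⟩

lemma volume_annulus_lt_top : volume (annulus r₁ r₂) < ⊤ :=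
  (measure_mono sdiff_subset).trans_lt measure_ball_lt_top

/-- The calibration bounds the integral by the perimeter, and the Minkowski bound on the perimeter
equals the integral, so neither inequality is strict. -/
lemma integral_annulusCurvature_annulus (h₁ : 0 ≤ r₁) (hr : r₁ < r₂) :
    ∫ x in annulus r₁ r₂, annulusCurvature r₁ r₂ x = (perimeter (annulus r₁ r₂)).toReal := by
  refine ((le_abs_self _).trans
    (abs_integral_annulusCurvature_le h₁ hr (finitePerimeter_annulus h₁ hr))).antisymm ?_
  have h₂ : 0 < r₂ := h₁.trans_lt hr
  have hπ := Real.pi_pos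
  refine (ENNReal.toReal_le_of_le_ofReal (by positivity) (perimeter_annulus_le h₁ hr)).trans
    (le_of_eq ?_)
  rw [setIntegral_congr_fun measurableSet_annulus fun x hx => annulusCurvature_of_mem hx,
    setIntegral_const, volume_real_annulus h₁ hr, smul_eq_mul]
  have h3 : r₂ - r₁ ≠ 0 := (sub_pos.2 hr).ne'
  field_simp
  ring

/-- The plane has perimeter zero, so the two-sided calibration bound leaves no room. -/
lemma integral_annulusCurvature (h₁ : 0 ≤ r₁) (hr : r₁ < r₂) :
    ∫ x, annulusCurvature r₁ r₂ x = 0 := by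
  have h := abs_integral_annulusCurvature_le h₁ hr finitePerimeter_univ
  simpa using h

lemma integral_annulusCurvature_compl (h₁ : 0 ≤ r₁) (hr : r₁ < r₂) :
    ∫ x in (annulus r₁ r₂)ᶜ, annulusCurvature r₁ r₂ x = -(perimeter (annulus r₁ r₂)).toReal := by
  have h := integral_add_compl (measurableSet_annulus (r₁ := r₁) (r₂ := r₂))
    (integrable_annulusCurvature h₁ hr)
  rw [integral_annulusCurvature h₁ hr, integral_annulusCurvature_annulus h₁ hr] at h
  linarith

end

/-! ### Minimizers in calibrated sets, and their level curvature. -/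

section

variable {d : ℕ} {h : EuclideanSpace ℝ (Fin d) → ℝ} {E : Set (EuclideanSpace ℝ (Fin d))} {c : ℝ}

/-- The set `E` is calibrated by `c * h`: its perimeter equals `c * ∫_E h`, and `c * ∫_F h` bounds
the perimeter of its subsets `F` from below. -/
structure IsCalibrated (h : EuclideanSpace ℝ (Fin d) → ℝ) (E : Set (EuclideanSpace ℝ (Fin d)))
    (c : ℝ) : Prop where
  pos : 0 < c
  finitePerimeter : FinitePerimeter E
  le : ∀ F, F ⊆ E → FinitePerimeter F → c * ∫ x in F, h x ≤ (perimeter F).toReal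
  eq : (perimeter E).toReal = c * ∫ x in E, h x

lemma setIntegral_nonneg_of_isDensity (hh : IsDensity h) (F : Set (EuclideanSpace ℝ (Fin d))) :
    0 ≤ ∫ x in F, h x :=
  integral_nonneg_of_ae (ae_restrict_of_ae (hh.2.mono fun _ hx => hx.le))

lemma setIntegral_mono_of_isDensity (hh : IsDensity h) {F G : Set (EuclideanSpace ℝ (Fin d))}
    (hFG : F ⊆ G) : ∫ x in F, h x ≤ ∫ x in G, h x :=
  setIntegral_mono_set hh.1.integrableOn (ae_restrict_of_ae (hh.2.mono fun _ hx => hx.le))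
    hFG.eventuallyLE

lemma ae_notMem_of_setIntegral_nonpos (hh : IsDensity h) {F : Set (EuclideanSpace ℝ (Fin d))}
    (hF : MeasurableSet F) (h0 : ∫ x in F, h x ≤ 0) : ∀ᵐ x, x ∉ F := by
  have h1 := h0.antisymm (setIntegral_nonneg_of_isDensity hh F)
  rw [integral_eq_zero_iff_of_nonneg_ae (ae_restrict_of_ae (hh.2.mono fun _ hx => hx.le))
    hh.1.integrableOn] at h1
  filter_upwards [(ae_restrict_iff' hF).1 h1, hh.2] with x hx hpos hxF
  exact hpos.ne' (hx hxF)

lemma energy_const_mul (l : ℝ) (h : EuclideanSpace ℝ (Fin d) → ℝ)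
    (F : Set (EuclideanSpace ℝ (Fin d))) :
    energy (fun x => l * h x) F = (perimeter F).toReal - l * ∫ x in F, h x := by
  rw [energy, integral_const_mul]

/-- In a calibrated set, the minimizers switch from empty to full at the level `c`. -/
theorem IsCalibrated.isMinimizerFamily (hE : IsCalibrated h E c) (hh : IsDensity h) :
    IsMinimizerFamily h E fun l => if l < c then ∅ else E where
  minimizes l hl := by
    split_ifs with hlc
    · refine ⟨empty_subset E, finitePerimeter_empty, fun F hFE hF => ?_⟩
      rw [energy_const_mul, energy_const_mul]
      -- The energy of `F` is at least `(c - l) * ∫_F h`, nonnegative below the level `c`.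
      have h1 := hE.le F hFE hF
      have h2 := mul_nonneg (sub_nonneg.2 hlc.le) (setIntegral_nonneg_of_isDensity hh F)
      simp only [perimeter_empty, ENNReal.toReal_zero, setIntegral_empty]
      linarith
    · refine ⟨subset_rfl, hE.finitePerimeter, fun F hFE hF => ?_⟩
      rw [energy_const_mul, energy_const_mul, hE.eq]
      -- Now `c - l ≤ 0`, so `(c - l) * ∫_F h` is least for `F = E`.
      have h1 := hE.le F hFE hF
      have h2 := mul_le_mul_of_nonneg_left (setIntegral_mono_of_isDensity hh hFE)
        (sub_nonneg.2 (not_lt.1 hlc))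
      linarith
  nested l m _ hlm := by
    split_ifs with h1 h2 h2
    · exact subset_rfl
    · exact empty_subset _
    · exact absurd (hlm.trans h2) h1
    · exact subset_rfl

/-- Comparison with `∅` gives `(c - l) * ∫_M h ≤ 0`, and `h` is positive. Above `c`, comparison with
`E` plays the same role. -/
lemma IsCalibrated.ae_notMem_of_lt (hE : IsCalibrated h E c) (hh : IsDensity h) {l : ℝ} (hlc : l < c)
    {M : Set (EuclideanSpace ℝ (Fin d))} (hM : IsMinimizerIn (fun x => l * h x) E M) :
    ∀ᵐ x, x ∉ M := by
  refine ae_notMem_of_setIntegral_nonpos hh hM.finitePerimeter.1 ?_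
  have h1 := hM.le ∅ (empty_subset E) finitePerimeter_empty
  rw [energy_const_mul, energy_const_mul] at h1
  simp only [perimeter_empty, ENNReal.toReal_zero, setIntegral_empty] at h1
  have h2 := hE.le M hM.subset hM.finitePerimeter
  refine le_of_mul_le_mul_left ?_ (sub_pos.2 hlc)
  linarith

lemma IsCalibrated.ae_mem_of_gt (hE : IsCalibrated h E c) (hh : IsDensity h) {l : ℝ} (hlc : c < l)
    {M : Set (EuclideanSpace ℝ (Fin d))} (hM : IsMinimizerIn (fun x => l * h x) E M) :
    ∀ᵐ x, x ∉ E \ M := by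
  refine ae_notMem_of_setIntegral_nonpos hh
    (hE.finitePerimeter.1.diff hM.finitePerimeter.1) ?_
  have h1 := hM.le E subset_rfl hE.finitePerimeter
  rw [energy_const_mul, energy_const_mul, hE.eq] at h1
  have h2 := hE.le M hM.subset hM.finitePerimeter
  rw [setIntegral_sdiff hM.finitePerimeter.1 hh.1.integrableOn hM.subset, sub_nonpos]
  refine le_of_mul_le_mul_left ?_ (sub_pos.2 hlc)
  linarith

/-- All families of minimizers in a calibrated set have the same level curvature. -/
theorem IsCalibrated.levelCurvature_eq (hE : IsCalibrated h E c) (hh : IsDensity h)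
    {S : ℝ → Set (EuclideanSpace ℝ (Fin d))} (hS : IsMinimizerFamily h E S) :
    ∀ᵐ x ∂volume.restrict E, levelCurvature h S x = c * h x := by
  -- Each level has its own exceptional null set; rational levels suffice by nestedness and keep the
  -- union null.
  have hlt : ∀ᵐ x, ∀ q : ℚ, 0 < (q : ℝ) → (q : ℝ) < c → x ∉ S q := by
    refine ae_all_iff.2 fun q => ?_
    by_cases hq : 0 < (q : ℝ) ∧ (q : ℝ) < c
    · filter_upwards [hE.ae_notMem_of_lt hh hq.2 (hS.minimizes q hq.1)] with x hx _ _ using hx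
    · exact .of_forall fun x h1 h2 => absurd ⟨h1, h2⟩ hq
  have hgt : ∀ᵐ x, ∀ q : ℚ, c < (q : ℝ) → x ∉ E \ S q := by
    refine ae_all_iff.2 fun q => ?_
    by_cases hq : c < (q : ℝ)
    · filter_upwards [hE.ae_mem_of_gt hh hq (hS.minimizes q (hE.pos.trans hq))] with x hx _ using hx
    · exact .of_forall fun x h1 => absurd h1 hq
  filter_upwards [ae_restrict_of_ae hlt, ae_restrict_of_ae hgt, ae_restrict_of_ae hh.2,
    ae_restrict_mem hE.finitePerimeter.1] with x h1 h2 hpos hxE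
  have hmem (q : ℚ) (hq : c < (q : ℝ)) : x ∈ S q := by
    by_contra hx
    exact h2 q hq ⟨hxE, hx⟩
  have hbdd : BddBelow {t | ∃ l, 0 < l ∧ x ∈ S l ∧ t = l * h x} := by
    refine ⟨0, ?_⟩
    rintro t ⟨l, hl, -, rfl⟩
    exact (mul_pos hl hpos).le
  obtain ⟨q₀, hq₀⟩ := exists_rat_gt c
  -- A level above `c` shows the set nonempty; otherwise `sInf` would be the default value 0.
  refine le_antisymm ?_ (le_csInf ⟨_, q₀, hE.pos.trans hq₀, hmem q₀ hq₀, rfl⟩ ?_)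
  · rw [← div_le_iff₀ hpos]
    by_contra! hlt'
    obtain ⟨q, hq, hq'⟩ := exists_rat_btwn hlt'
    rw [lt_div_iff₀ hpos] at hq'
    exact hq'.not_ge (csInf_le hbdd ⟨q, hE.pos.trans hq, hmem q hq, rfl⟩)
  · rintro t ⟨l, hl, hx, rfl⟩
    gcongr
    by_contra! hlc
    obtain ⟨q, hq, hq'⟩ := exists_rat_btwn hlc
    exact h1 q (hl.trans hq) hq' (hS.nested l q hl hq hx)

/-! ### Optimality of the curvature of the annulus. -/

variable {r₁ r₂ : ℝ}

lemma isCalibrated_annulus (h₁ : 0 ≤ r₁) (hr : r₁ < r₂) {h : EuclideanSpace ℝ (Fin 2) → ℝ}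
    (hA : ∀ᵐ x ∂volume.restrict (annulus r₁ r₂), h x = 1) :
    IsCalibrated h (annulus r₁ r₂) (2 / (r₂ - r₁)) := by
  have key (F) (hF : F ⊆ annulus r₁ r₂) :
      2 / (r₂ - r₁) * ∫ x in F, h x = ∫ x in F, annulusCurvature r₁ r₂ x := by
    rw [← integral_const_mul]
    refine integral_congr_ae ?_
    filter_upwards [ae_restrict_of_ae_restrict_of_subset hF hA,
      ae_restrict_of_ae_restrict_of_subset hF (ae_restrict_mem measurableSet_annulus)] with x hx hxA
    rw [hx, annulusCurvature_of_mem hxA, mul_one]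
  refine ⟨div_pos two_pos (sub_pos.2 hr), finitePerimeter_annulus h₁ hr, fun F hFA hF => ?_, ?_⟩
  · rw [key F hFA]
    exact (le_abs_self _).trans (abs_integral_annulusCurvature_le h₁ hr hF)
  · rw [key _ subset_rfl, integral_annulusCurvature_annulus h₁ hr]

/-- The density which is one on the annulus, and minus the curvature outside of it. -/
def annulusDensity (r₁ r₂ : ℝ) (x : EuclideanSpace ℝ (Fin 2)) : ℝ :=
  (annulus r₁ r₂).indicator (fun _ => 1) x - (annulus r₁ r₂)ᶜ.indicator (annulusCurvature r₁ r₂) x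

lemma annulusDensity_of_mem {x : EuclideanSpace ℝ (Fin 2)} (hx : x ∈ annulus r₁ r₂) :
    annulusDensity r₁ r₂ x = 1 := by
  simp [annulusDensity, hx]

lemma annulusDensity_of_notMem {x : EuclideanSpace ℝ (Fin 2)} (hx : x ∉ annulus r₁ r₂) :
    annulusDensity r₁ r₂ x = -annulusCurvature r₁ r₂ x := by
  simp [annulusDensity, hx]

lemma isDensity_annulusDensity (h₁ : 0 ≤ r₁) (hr : r₁ < r₂) : IsDensity (annulusDensity r₁ r₂) := by
  constructor
  · refine Integrable.sub ?_ ((integrable_annulusCurvature h₁ hr).indicator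
      measurableSet_annulus.compl)
    exact (integrable_indicator_iff measurableSet_annulus).2
      (integrableOn_const volume_annulus_lt_top.ne)
  · refine .of_forall fun x => ?_
    by_cases hx : x ∈ annulus r₁ r₂
    · rw [annulusDensity_of_mem hx]
      exact one_pos
    · rw [annulusDensity_of_notMem hx, neg_pos]
      exact annulusCurvature_neg_of_notMem h₁ hr hx

/-- The density was chosen as `-κ` off the annulus, so the level there is 1 and the optimal
curvature gives back `κ`. -/
lemma isCalibrated_compl_annulus (h₁ : 0 ≤ r₁) (hr : r₁ < r₂) :
    IsCalibrated (annulusDensity r₁ r₂) (annulus r₁ r₂)ᶜ 1 := by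
  have hfin := finitePerimeter_annulus h₁ hr
  have hper := perimeter_compl hfin.1
  have key (F) (hF : F ⊆ (annulus r₁ r₂)ᶜ) (hFm : MeasurableSet F) :
      1 * ∫ x in F, annulusDensity r₁ r₂ x = -∫ x in F, annulusCurvature r₁ r₂ x := by
    rw [one_mul, ← integral_neg]
    exact setIntegral_congr_fun hFm fun x hx => annulusDensity_of_notMem (hF hx)
  refine ⟨one_pos, ⟨hfin.1.compl, hper ▸ hfin.2⟩, fun F hFA hF => ?_, ?_⟩
  · rw [key F hFA hF.1]
    exact (neg_le_abs _).trans (abs_integral_annulusCurvature_le h₁ hr hF)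
  · rw [key _ subset_rfl hfin.1.compl, integral_annulusCurvature_compl h₁ hr, neg_neg, hper]

lemma isOptimalCurvature_annulusCurvature (h₁ : 0 ≤ r₁) (hr : r₁ < r₂) :
    IsOptimalCurvature (annulusDensity r₁ r₂) (annulus r₁ r₂) (annulusCurvature r₁ r₂) := by
  have hh := isDensity_annulusDensity h₁ hr
  have hA : ∀ᵐ x ∂volume.restrict (annulus r₁ r₂), annulusDensity r₁ r₂ x = 1 :=
    (ae_restrict_mem measurableSet_annulus).mono fun x hx => annulusDensity_of_mem hx
  have hin := isCalibrated_annulus h₁ hr hA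
  have hout := isCalibrated_compl_annulus h₁ hr
  refine ⟨⟨_, hin.isMinimizerFamily hh, ?_⟩, ⟨_, hout.isMinimizerFamily hh, ?_⟩⟩
  · filter_upwards [hin.levelCurvature_eq hh (hin.isMinimizerFamily hh),
      ae_restrict_mem measurableSet_annulus] with x hx hxA
    rw [hx, annulusDensity_of_mem hxA, annulusCurvature_of_mem hxA, mul_one]
  · filter_upwards [hout.levelCurvature_eq hh (hout.isMinimizerFamily hh),
      ae_restrict_mem measurableSet_annulus.compl] with x hx hxA
    rw [hx, annulusDensity_of_notMem hxA, one_mul, neg_neg]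

lemma isVariationalCurvature_annulusCurvature (h₁ : 0 ≤ r₁) (hr : r₁ < r₂) :
    IsVariationalCurvature (annulus r₁ r₂) (annulusCurvature r₁ r₂) := by
  refine ⟨integrable_annulusCurvature h₁ hr, subset_univ _, finitePerimeter_annulus h₁ hr,
    fun F _ hF => ?_⟩
  rw [energy, energy, integral_annulusCurvature_annulus h₁ hr, sub_self, sub_nonneg]
  exact (le_abs_self _).trans (abs_integral_annulusCurvature_le h₁ hr hF)

/-- A variational mean curvature of `E` has `L¹` norm at least twice the perimeter of `E`. -/
theorem two_mul_perimeter_le_integral_norm {κ : EuclideanSpace ℝ (Fin d) → ℝ}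
    (hκ : IsVariationalCurvature E κ) : 2 * (perimeter E).toReal ≤ ∫ x, ‖κ x‖ := by
  have hE := hκ.2.finitePerimeter.1
  have h1 := hκ.2.le ∅ (subset_univ _) finitePerimeter_empty
  have h2 := hκ.2.le univ subset_rfl finitePerimeter_univ
  simp only [energy, perimeter_empty, perimeter_univ, ENNReal.toReal_zero, setIntegral_empty,
    setIntegral_univ, sub_zero, zero_sub] at h1 h2
  have h3 := integral_add_compl hE hκ.1
  have h4 := integral_add_compl hE hκ.1.norm
  have h5 := norm_integral_le_integral_norm (μ := volume.restrict E) κ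
  have h6 := norm_integral_le_integral_norm (μ := volume.restrict Eᶜ) κ
  rw [Real.norm_eq_abs] at h5 h6
  have h7 := le_abs_self (∫ x in E, κ x)
  have h8 := neg_le_abs (∫ x in Eᶜ, κ x)
  linarith

/-- The curvature has constant sign on the annulus and on its complement, and each part contributes
one perimeter: the general lower bound is attained. -/
lemma integral_norm_annulusCurvature (h₁ : 0 ≤ r₁) (hr : r₁ < r₂) :
    ∫ x, ‖annulusCurvature r₁ r₂ x‖ = 2 * (perimeter (annulus r₁ r₂)).toReal := by
  have hA := measurableSet_annulus (r₁ := r₁) (r₂ := r₂)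
  rw [← integral_add_compl hA (integrable_annulusCurvature h₁ hr).norm]
  have h3 : ∫ x in annulus r₁ r₂, ‖annulusCurvature r₁ r₂ x‖
      = ∫ x in annulus r₁ r₂, annulusCurvature r₁ r₂ x :=
    setIntegral_congr_fun hA fun x hx => by
      rw [annulusCurvature_of_mem hx]
      exact Real.norm_of_nonneg (div_nonneg two_pos.le (sub_pos.2 hr).le)
  have h4 : ∫ x in (annulus r₁ r₂)ᶜ, ‖annulusCurvature r₁ r₂ x‖
      = -∫ x in (annulus r₁ r₂)ᶜ, annulusCurvature r₁ r₂ x := by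
    rw [← integral_neg]
    exact setIntegral_congr_fun hA.compl fun x hx =>
      Real.norm_of_nonpos (annulusCurvature_neg_of_notMem h₁ hr hx).le
  rw [h3, h4, integral_annulusCurvature_annulus h₁ hr, integral_annulusCurvature_compl h₁ hr]
  ring

end

end VarCurv

end

/-- First part: an optimal curvature of the annulus whose density is one on the annulus exists, and
it can be taken to be a variational mean curvature with least `L¹` norm. Second part: every optimal
curvature whose density is one on the annulus has the stated constant value on the annulus. -/
theorem mainTheorem12 (r₁ r₂ : ℝ) (hr₁ : 0 ≤ r₁) (hr : r₁ < r₂) :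
    (∃ h κ : EuclideanSpace ℝ (Fin 2) → ℝ,
      VarCurv.IsDensity h ∧
      (∀ᵐ x ∂(volume.restrict (VarCurv.annulus r₁ r₂)), h x = 1) ∧
      VarCurv.IsOptimalCurvature h (VarCurv.annulus r₁ r₂) κ ∧
      VarCurv.IsVariationalCurvature (VarCurv.annulus r₁ r₂) κ ∧
      ∀ κ' : EuclideanSpace ℝ (Fin 2) → ℝ,
        VarCurv.IsVariationalCurvature (VarCurv.annulus r₁ r₂) κ' →
          ∫ x, ‖κ x‖ ≤ ∫ x, ‖κ' x‖) ∧
    ∀ h κ : EuclideanSpace ℝ (Fin 2) → ℝ,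
      VarCurv.IsDensity h →
      (∀ᵐ x ∂(volume.restrict (VarCurv.annulus r₁ r₂)), h x = 1) →
      VarCurv.IsOptimalCurvature h (VarCurv.annulus r₁ r₂) κ →
        ∀ᵐ x ∂(volume.restrict (VarCurv.annulus r₁ r₂)),
          κ x = 2 * (r₁ + r₂) / (r₂ ^ 2 - r₁ ^ 2) := by
  refine ⟨⟨VarCurv.annulusDensity r₁ r₂, VarCurv.annulusCurvature r₁ r₂,
    VarCurv.isDensity_annulusDensity hr₁ hr,
    (ae_restrict_mem VarCurv.measurableSet_annulus).mono fun x hx =>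
      VarCurv.annulusDensity_of_mem hx,
    VarCurv.isOptimalCurvature_annulusCurvature hr₁ hr,
    VarCurv.isVariationalCurvature_annulusCurvature hr₁ hr, fun κ' hκ' => ?_⟩,
    fun h κ hh hA hκ => ?_⟩
  · rw [VarCurv.integral_norm_annulusCurvature hr₁ hr]
    exact VarCurv.two_mul_perimeter_le_integral_norm hκ'
  · obtain ⟨S, hS, hSκ⟩ := hκ.inside
    filter_upwards [hSκ, hA, (VarCurv.isCalibrated_annulus hr₁ hr hA).levelCurvature_eq hh hS]
      with x h1 h2 h3
    rw [h1, h3, h2, mul_one]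
    have h4 : r₂ - r₁ ≠ 0 := (sub_pos.2 hr).ne'
    have h5 : r₂ + r₁ ≠ 0 := (add_pos_of_pos_of_nonneg (hr₁.trans_lt hr) hr₁).ne'
    have h6 : r₂ ^ 2 - r₁ ^ 2 = (r₂ - r₁) * (r₂ + r₁) := by ring
    rw [h6]
    field_simp
    ring
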